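/- A (turn-based stochastic) game $\mathcal G$ consists of a countable set $S$ of states, partitioned into the states $S_\Box$ of the maximizer, the states $S_\Diamond$ of the minimizer and the random states $S_\bigcirc$; a transition relation ${\longrightarrow}\subseteq S\times S$ such that every state has a successor; and, for each $s\in S_\bigcirc$, a probability distribution $P(s)$ over the successors of $s$. It is finitely branching if every state has only finitely many successors. A strategy of a player assigns to every finite sequence of states that ends in a state $s$ of this player a probability distribution over the successors of $s$; it is MD (memoryless deterministic) if this is a Dirac distribution that depends only on $s$. An initial state $s$, a maximizer strategy $\sigma$ and a minimizer strategy $\pi$ induce a probability measure $\mathcal P_{s,\sigma,\pi}$ on $S^\omega$. For $T\subseteq S$ let $\mathrm{Reach}(T)=\{s_0s_1\cdots\in S^\omega : \exists i.\ s_i\in T\}$. The value $\mathrm{val}(s)$ is the common value of $\sup_\sigma\inf_\pi\mathcal P_{s,\sigma,\pi}(\mathrm{Reach}(T))$ and $\inf_\pi\sup_\sigma\mathcal P_{s,\sigma,\pi}(\mathrm{Reach}(T))$. A transition $s\longrightarrow s'$ is value-decreasing if $\mathrm{val}(s)>\mathrm{val}(s')$, and value-increasing if $\mathrm{val}(s)<\mathrm{val}(s')$.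 Theorem. Let $\mathcal G$ be a finitely branching game, $T\subseteq S$, ${\rhd}\in\{\ge,>\}$ and $c\in[0,1]$. Suppose that at least one of the following conditions holds: (1) no transition $s\longrightarrow s'$ with $s\in S_\Box$ is value-decreasing; (2) no transition $s\longrightarrow s'$ with $s\in S_\Diamond$ is value-increasing; (3) $\rhd$ is $\ge$ and $c=1$; (4) $\rhd$ is $>$. Then the objective $(\mathrm{Reach}(T),\rhd c)$ is strongly MD-determined: for every state $s\in S$, either there is an MD strategy $\sigma$ of the maximizer such that $\mathcal P_{s,\sigma,\pi}(\mathrm{Reach}(T))\rhd c$ for all strategies $\pi$ of the minimizer, or there is an MD strategy $\pi$ of the minimizer such that $\mathcal P_{s,\sigma,\pi}(\mathrm{Reach}(T))\not\rhd c$ for all strategies $\sigma$ of the maximizer. -/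

import Mathlib

open MeasureTheory ProbabilityTheory
open scoped NNReal ENNReal

/-- Who decides at a state: the maximizer, the minimizer, or chance. -/
inductive StateKind where
  | maximizer
  | minimizer
  | random

/-- A turn-based stochastic game (2½-player game) with state space `S`. -/
structure StochasticGame (S : Type*) where
  /-- the partition of the states -/
  kind : S → StateKind
  /-- the transition relation -/
  step : S → S → Prop
  /-- every state has a successor -/
  exists_step : ∀ s, ∃ s', step s s'
  /-- the probability function, defined on random states -/
  prob : {s : S // kind s = .random} → PMF S
  /-- `prob s` is a distribution over the successors of `s` -/
  step_of_mem_support : ∀ s, ∀ s' ∈ (prob s).support, step s.1 s'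

namespace StochasticGame

section Basic

variable {S : Type*} (G : StochasticGame S)

/-- Each state has only finitely many successors. -/
def FinitelyBranching : Prop := ∀ s, {s' | G.step s s'}.Finite

/-- A (history-dependent, randomized) strategy for the player who controls the states of kind `k`.
`choice w s` is the distribution chosen after the finite sequence `w s`, where `s` is the
current state and `w` lists the earlier states, oldest first. -/
structure Strategy (k : StateKind) where
  choice : List S → {s : S // G.kind s = k} → PMF S
  step_of_mem_support : ∀ w s, ∀ s' ∈ (choice w s).support, G.step s.1 s'

abbrev MaxStrategy := G.Strategy .maximizer

abbrev MinStrategy := G.Strategy .minimizer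

/-- Memoryless and deterministic: the choice is a Dirac distribution that depends only on the
current state. -/
def Strategy.IsMD {G : StochasticGame S} {k : StateKind} (τ : G.Strategy k) : Prop :=
  ∃ f : {s : S // G.kind s = k} → S, ∀ w s, τ.choice w s = PMF.pure (f s)

/-- The distribution of the next state after the finite sequence `w s`. -/
noncomputable def nextDist (σ : G.MaxStrategy) (π : G.MinStrategy) (w : List S) (s : S) : PMF S :=
  match h : G.kind s with
  | .maximizer => σ.choice w ⟨s, h⟩
  | .minimizer => π.choice w ⟨s, h⟩
  | .random => G.prob ⟨s, h⟩

/-- The states at times `0, …, n - 1` of a finite sequence indexed by `0, …, n`. -/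
def earlier {n : ℕ} (h : (i : Finset.Iic n) → S) : List S :=
  List.ofFn fun i : Fin n => h ⟨i, Finset.mem_Iic.2 i.2.le⟩

/-- The state at time `n` of a finite sequence indexed by `0, …, n`. -/
def current {n : ℕ} (h : (i : Finset.Iic n) → S) : S :=
  h ⟨n, Finset.mem_Iic.2 le_rfl⟩

end Basic

section Measure

variable {S : Type*} [Countable S] [MeasurableSpace S] [DiscreteMeasurableSpace S]
  (G : StochasticGame S)

/-- The law of the state at time `n + 1` given the states at times `0, …, n`. -/
noncomputable def stepKernel (σ : G.MaxStrategy) (π : G.MinStrategy) (n : ℕ) :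
    Kernel ((i : Finset.Iic n) → (fun _ : ℕ => S) i) ((fun _ : ℕ => S) (n + 1)) where
  toFun h := (G.nextDist σ π (earlier h) (current h)).toMeasure
  measurable' := Measurable.of_discrete

instance (σ : G.MaxStrategy) (π : G.MinStrategy) (n : ℕ) :
    IsMarkovKernel (G.stepKernel σ π n) :=
  ⟨fun h => PMF.toMeasure.isProbabilityMeasure (G.nextDist σ π (earlier h) (current h))⟩

/-- The probability measure on infinite sequences of states that is induced by the initial state
`s₀` and the two strategies (Ionescu-Tulcea). The σ-algebra is the product of the discrete ones,
that is, the one generated by the cylinder sets. -/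
noncomputable def playMeasure (s₀ : S) (σ : G.MaxStrategy) (π : G.MinStrategy) :
    Measure (ℕ → S) :=
  Kernel.traj (X := fun _ => S) (G.stepKernel σ π) 0 (fun _ => s₀)

/-- `v` is the value of `s` for the event `E`: sup inf and inf sup both equal `v`. -/
def HasValue (E : Set (ℕ → S)) (s : S) (v : ℝ≥0∞) : Prop :=
  (⨆ σ : G.MaxStrategy, ⨅ π : G.MinStrategy, G.playMeasure s σ π E) = v ∧
    (⨅ π : G.MinStrategy, ⨆ σ : G.MaxStrategy, G.playMeasure s σ π E) = v

/-- `s` and `s'` have values, and that of `s'` is smaller. -/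
def ValueDecreasing (E : Set (ℕ → S)) (s s' : S) : Prop :=
  ∃ v v', G.HasValue E s v ∧ G.HasValue E s' v' ∧ v' < v

/-- `s` and `s'` have values, and that of `s'` is larger. -/
def ValueIncreasing (E : Set (ℕ → S)) (s s' : S) : Prop :=
  ∃ v v', G.HasValue E s v ∧ G.HasValue E s' v' ∧ v < v'

/-- The event that the target set `T` is visited. -/
def reach (T : Set S) : Set (ℕ → S) := {w | ∃ i, w i ∈ T}

/-- The comparison in a threshold objective: `≥` or `>`. -/
inductive ThresholdRel where
  | ge
  | gt

/-- `r.Holds p c` says `p ≥ c` or `p > c`. -/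
def ThresholdRel.Holds : ThresholdRel → ℝ≥0∞ → ℝ≥0∞ → Prop
  | .ge, p, c => p ≥ c
  | .gt, p, c => p > c

/-- From every state, the maximizer has an MD strategy that wins the threshold objective
`(E, r c)`, or the minimizer has an MD strategy that wins its complement. -/
def StronglyMDDetermined (E : Set (ℕ → S)) (r : ThresholdRel) (c : ℝ≥0∞) : Prop :=
  ∀ s : S,
    (∃ σ : G.MaxStrategy, σ.IsMD ∧ ∀ π : G.MinStrategy, r.Holds (G.playMeasure s σ π E) c) ∨
    (∃ π : G.MinStrategy, π.IsMD ∧ ∀ σ : G.MaxStrategy, ¬ r.Holds (G.playMeasure s σ π E) c)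

end Measure

end StochasticGame

/-!
Because the game is finitely branching, the limit of the Bellman iterates of `0` satisfies the
Bellman equation. The minimizer keeps the play from exceeding this limit by moving to a successor
where it is least. The maximizer gets arbitrarily close to it from any one state by an MD strategy,
namely by moving greedily in the game discounted by a factor near `1`. So the limit is the value,
and only the threshold that equals the value of the initial state needs an argument.

Suppose the maximizer has only moves that keep the value. Committing to the moves of a near-optimal
MD strategy around one state keeps at least half of that state's value, and doing so for one state
after another yields a single MD strategy that guarantees half of the value everywhere. Such a
guarantee improves itself to the full value: while the target is still missing, what remains is
always at least half of the value, and the value is conserved in the mean.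

If instead the minimizer has only moves that keep the value in a region `Z`, restrict the maximizer
to moves to a successor of greatest value. The states of `Z` where this lowers the value cannot be
won at the threshold; they may be turned into losing states, which lowers the value at further
states, and so on transfinitely. At these states the minimizer has an MD strategy that keeps every
strategy of the maximizer strictly below the value, by induction on the stage. At the remaining
states of `Z` all restricted moves keep the value, and the first construction applies. For
condition (2), `Z` is the set of all states, and for condition (3) the set of states of value `1`.
-/

namespace StochasticGame

section Expectation

variable {α : Type*} {p : PMF α} {f g : α → ℝ≥0∞}

/-- The mean of `f` under the discrete distribution `p`, as a sum, so that `α` needs no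
σ-algebra. -/
noncomputable def expectation (p : PMF α) (f : α → ℝ≥0∞) : ℝ≥0∞ := ∑' y, p y * f y

theorem expectation_mono (h : ∀ y ∈ p.support, f y ≤ g y) : expectation p f ≤ expectation p g := by
  refine ENNReal.tsum_le_tsum fun y => ?_
  by_cases hy : p y = 0
  · simp [hy]
  · exact mul_le_mul_right (h y ((p.mem_support_iff y).2 hy)) (p y)

theorem expectation_congr (h : ∀ y ∈ p.support, f y = g y) : expectation p f = expectation p g :=
  le_antisymm (expectation_mono fun y hy => (h y hy).le)
    (expectation_mono fun y hy => (h y hy).ge)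

theorem expectation_const (p : PMF α) (c : ℝ≥0∞) : expectation p (fun _ => c) = c := by
  rw [expectation, ENNReal.tsum_mul_right, p.tsum_coe, one_mul]

theorem expectation_le {c : ℝ≥0∞} (h : ∀ y ∈ p.support, f y ≤ c) : expectation p f ≤ c :=
  (expectation_mono h).trans_eq (expectation_const p c)

theorem le_expectation {c : ℝ≥0∞} (h : ∀ y ∈ p.support, c ≤ f y) : c ≤ expectation p f :=
  (expectation_const p c).symm.trans_le (expectation_mono h)

theorem expectation_pure (x : α) (f : α → ℝ≥0∞) : expectation (PMF.pure x) f = f x := by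
  rw [expectation, tsum_eq_single x fun y hy => by simp [hy]]
  simp

theorem expectation_const_mul (p : PMF α) (c : ℝ≥0∞) (f : α → ℝ≥0∞) :
    expectation p (fun y => c * f y) = c * expectation p f := by
  simp only [expectation, mul_left_comm _ c, ENNReal.tsum_mul_left]

theorem expectation_add (p : PMF α) (f g : α → ℝ≥0∞) :
    expectation p (fun y => f y + g y) = expectation p f + expectation p g := by
  simp only [expectation, mul_add, ENNReal.tsum_add]

theorem expectation_iSup (p : PMF α) {f : ℕ → α → ℝ≥0∞} (hf : Monotone f) :
    expectation p (fun y => ⨆ n, f n y) = ⨆ n, expectation p (f n) := by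
  simp only [expectation, ENNReal.tsum_eq_iSup_sum, ENNReal.mul_iSup]
  rw [iSup_comm]
  refine iSup_congr fun F => ENNReal.finsetSum_iSup_of_monotone fun y m n hmn => ?_
  exact mul_le_mul_right (hf hmn y) (p y)

theorem eq_of_expectation_le (hfg : ∀ y ∈ p.support, f y ≤ g y) (hf : expectation p f ≠ ∞)
    (h : expectation p g ≤ expectation p f) : ∀ y ∈ p.support, f y = g y := by
  intro y hy
  refine (hfg y hy).antisymm (not_lt.1 fun hlt => h.not_gt ?_)
  refine ENNReal.tsum_lt_tsum (i := y) hf (fun z => ?_)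
    (ENNReal.mul_lt_mul_right ((p.mem_support_iff y).1 hy) (p.apply_ne_top y) hlt)
  by_cases hz : p z = 0
  · simp [hz]
  · exact mul_le_mul_right (hfg z ((p.mem_support_iff z).2 hz)) (p z)

theorem lintegral_toMeasure [Countable α] [MeasurableSpace α] [DiscreteMeasurableSpace α]
    (p : PMF α) (f : α → ℝ≥0∞) : ∫⁻ y, f y ∂p.toMeasure = expectation p f := by
  simp only [lintegral_countable', p.toMeasure_apply_singleton _ (MeasurableSet.of_discrete),
    mul_comm (f _), expectation]

end Expectation

section Bellman

variable {S : Type*} {G : StochasticGame S}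

/-- The possible next states. -/
def successors (G : StochasticGame S) (x : S) : Set S := {y | G.step x y}

theorem successors_nonempty (x : S) : (G.successors x).Nonempty := G.exists_step x

open Classical in
/-- The one-step reachability operator of the game in which the play stops with payoff `1` in `T`
and with payoff `0` in `D \ T`, and in which the maximizer has to move from `x` into `A x`. -/
noncomputable def bellman (G : StochasticGame S) (A : S → Set S) (T D : Set S) (f : S → ℝ≥0∞)
    (x : S) : ℝ≥0∞ :=
  if x ∈ T ∪ D then T.indicator 1 x else
    match h : G.kind x with
    | .maximizer => ⨆ y ∈ A x, f y
    | .minimizer => ⨅ y ∈ G.successors x, f y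
    | .random => expectation (G.prob ⟨x, h⟩) f

variable {A B : S → Set S} {T D E : Set S} {f g w : S → ℝ≥0∞} {x : S}

theorem bellman_of_terminal (hx : x ∈ T ∪ D) : G.bellman A T D f x = T.indicator 1 x := by
  rw [bellman, if_pos hx]

theorem bellman_max (hx : x ∉ T ∪ D) (h : G.kind x = .maximizer) :
    G.bellman A T D f x = ⨆ y ∈ A x, f y := by
  rw [bellman, if_neg hx]
  split <;> simp_all

theorem bellman_min (hx : x ∉ T ∪ D) (h : G.kind x = .minimizer) :
    G.bellman A T D f x = ⨅ y ∈ G.successors x, f y := by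
  rw [bellman, if_neg hx]
  split <;> simp_all

theorem bellman_random (hx : x ∉ T ∪ D) (h : G.kind x = .random) :
    G.bellman A T D f x = expectation (G.prob ⟨x, h⟩) f := by
  rw [bellman, if_neg hx]
  split <;> simp_all

theorem bellman_of_mem_target (hx : x ∈ T) : G.bellman A T D f x = 1 := by
  rw [bellman_of_terminal (Or.inl hx), Set.indicator_of_mem hx, Pi.one_apply]

theorem bellman_mono (hAB : A x ⊆ B x) (hED : E ⊆ D) (hfg : ∀ y, f y ≤ g y) :
    G.bellman A T D f x ≤ G.bellman B T E g x := by
  by_cases hE : x ∈ T ∪ E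
  · rw [bellman_of_terminal hE, bellman_of_terminal (Set.union_subset_union_right T hED hE)]
  by_cases hD : x ∈ T ∪ D
  · rw [bellman_of_terminal hD, Set.indicator_of_notMem fun hT => hE (Or.inl hT)]
    exact zero_le
  cases hk : G.kind x
  · rw [bellman_max hD hk, bellman_max hE hk]
    exact (biSup_mono hAB).trans (iSup₂_mono fun y _ => hfg y)
  · rw [bellman_min hD hk, bellman_min hE hk]
    exact iInf₂_mono fun y _ => hfg y
  · rw [bellman_random hD hk, bellman_random hE hk]
    exact expectation_mono fun y _ => hfg y

theorem bellman_le_bellman_of_forall_le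
    (h : x ∉ T ∪ D → G.kind x = .maximizer → ∀ y ∈ A x, f y ≤ ⨆ z ∈ B x, f z) :
    G.bellman A T D f x ≤ G.bellman B T D f x := by
  by_cases hx : x ∈ T ∪ D
  · rw [bellman_of_terminal hx, bellman_of_terminal hx]
  cases hk : G.kind x
  · rw [bellman_max hx hk, bellman_max hx hk]
    exact iSup₂_le (h hx hk)
  · rw [bellman_min hx hk, bellman_min hx hk]
  · rw [bellman_random hx hk, bellman_random hx hk]

theorem bellman_congr (hA : A x ⊆ G.successors x) (hAB : A x = B x)
    (hfg : ∀ y ∈ G.successors x, f y = g y) : G.bellman A T D f x = G.bellman B T D g x := by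
  by_cases hx : x ∈ T ∪ D
  · rw [bellman_of_terminal hx, bellman_of_terminal hx]
  cases hk : G.kind x
  · rw [bellman_max hx hk, bellman_max hx hk, ← hAB]
    exact biSup_congr fun y hy => hfg y (hA hy)
  · rw [bellman_min hx hk, bellman_min hx hk]
    exact biInf_congr hfg
  · rw [bellman_random hx hk, bellman_random hx hk]
    exact expectation_congr fun y hy => hfg y (G.step_of_mem_support ⟨x, hk⟩ y hy)

theorem bellman_le_one (hf : ∀ y, f y ≤ 1) (x : S) : G.bellman A T D f x ≤ 1 := by
  by_cases hx : x ∈ T ∪ D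
  · rw [bellman_of_terminal hx]
    exact Set.indicator_apply_le' (fun _ => le_rfl) fun _ => zero_le
  cases hk : G.kind x
  · rw [bellman_max hx hk]
    exact iSup₂_le fun y _ => hf y
  · obtain ⟨y, hy⟩ := G.successors_nonempty x
    rw [bellman_min hx hk]
    exact (iInf₂_le y hy).trans (hf y)
  · rw [bellman_random hx hk]
    exact expectation_le fun y _ => hf y

theorem bellman_add_const_le (f : S → ℝ≥0∞) (c : ℝ≥0∞) (x : S) :
    G.bellman A T D (fun y => f y + c) x ≤ G.bellman A T D f x + c := by
  by_cases hx : x ∈ T ∪ D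
  · rw [bellman_of_terminal hx, bellman_of_terminal hx]
    exact le_self_add
  cases hk : G.kind x
  · rw [bellman_max hx hk, bellman_max hx hk]
    exact iSup₂_le fun y hy => by gcongr; exact le_iSup₂ (f := fun y _ => f y) y hy
  · rw [bellman_min hx hk, bellman_min hx hk]
    simp only [iInf_subtype', ENNReal.iInf_add, le_refl]
  · rw [bellman_random hx hk, bellman_random hx hk, expectation_add, expectation_const]

theorem mul_bellman_le {c : ℝ≥0∞} (hc : c ≤ 1) (f : S → ℝ≥0∞) (x : S) :
    c * G.bellman A T D f x ≤ G.bellman A T D (fun y => c * f y) x := by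
  by_cases hx : x ∈ T ∪ D
  · rw [bellman_of_terminal hx, bellman_of_terminal hx]
    exact mul_le_of_le_one_left' hc
  cases hk : G.kind x
  · rw [bellman_max hx hk, bellman_max hx hk]
    simp only [ENNReal.mul_iSup, le_refl]
  · rw [bellman_min hx hk, bellman_min hx hk]
    exact le_iInf₂ fun y hy => mul_le_mul_right (iInf₂_le y hy) c
  · rw [bellman_random hx hk, bellman_random hx hk, expectation_const_mul]

theorem mul_add_mul_bellman_le {a b : ℝ≥0∞} (hab : a + b = 1)
    (hw : w x ≤ G.bellman B T D w x) (hA : (A x).Nonempty)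
    (hAw : x ∉ T ∪ D → G.kind x = .maximizer → ∀ y ∈ A x, w y = w x) (f : S → ℝ≥0∞) :
    a * w x + b * G.bellman A T D f x ≤ G.bellman A T D (fun y => a * w y + b * f y) x := by
  by_cases hx : x ∈ T ∪ D
  · rw [bellman_of_terminal hx] at hw
    rw [bellman_of_terminal hx, bellman_of_terminal hx]
    calc a * w x + b * T.indicator 1 x ≤ a * T.indicator 1 x + b * T.indicator 1 x := by gcongr
      _ = T.indicator 1 x := by rw [← add_mul, hab, one_mul]
  cases hk : G.kind x
  · rw [bellman_max hx hk, bellman_max hx hk]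
    simp only [ENNReal.mul_iSup]
    rw [ENNReal.add_biSup hA]
    exact iSup₂_mono fun y hy => by rw [hAw hx hk y hy]
  · rw [bellman_min hx hk] at hw
    rw [bellman_min hx hk, bellman_min hx hk]
    refine le_iInf₂ fun y hy => ?_
    gcongr
    · exact hw.trans (iInf₂_le y hy)
    · exact iInf₂_le y hy
  · rw [bellman_random hx hk] at hw
    rw [bellman_random hx hk, bellman_random hx hk, expectation_add, expectation_const_mul,
      expectation_const_mul]
    gcongr

theorem bellman_iSup (hG : G.FinitelyBranching) {f : ℕ → S → ℝ≥0∞} (hf : Monotone f) (x : S) :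
    G.bellman A T D (fun y => ⨆ n, f n y) x = ⨆ n, G.bellman A T D (f n) x := by
  by_cases hx : x ∈ T ∪ D
  · simp only [bellman_of_terminal hx, ciSup_const]
  cases hk : G.kind x
  · simp only [bellman_max hx hk, iSup_comm (ι := ℕ)]
  · simp only [bellman_min hx hk]
    exact (Set.Finite.iSup_biInf_of_monotone (hG x) fun y _ m n hmn => hf hmn y).symm
  · simp only [bellman_random hx hk]
    exact expectation_iSup _ hf

end Bellman

section Value

variable {S : Type*} {G : StochasticGame S} {A B : S → Set S} {T D E : Set S}
  {f g w : S → ℝ≥0∞} {x : S}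

/-- The value when `T` has to be visited before time `n`, for the game of `bellman`. -/
noncomputable def valueWithin (G : StochasticGame S) (A : S → Set S) (T D : Set S) :
    ℕ → S → ℝ≥0∞
  | 0 => 0
  | n + 1 => G.bellman A T D (valueWithin G A T D n)

/-- The value of the objective to reach `T`, for the game of `bellman`. -/
noncomputable def value (G : StochasticGame S) (A : S → Set S) (T D : Set S) (x : S) : ℝ≥0∞ :=
  ⨆ n, G.valueWithin A T D n x

theorem valueWithin_zero (x : S) : G.valueWithin A T D 0 x = 0 := rfl

theorem valueWithin_succ (n : ℕ) (x : S) :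
    G.valueWithin A T D (n + 1) x = G.bellman A T D (G.valueWithin A T D n) x := rfl

theorem valueWithin_monotone : Monotone (G.valueWithin A T D) := by
  refine monotone_nat_of_le_succ fun n => ?_
  induction n with
  | zero => exact fun _ => zero_le
  | succ n ih => exact fun x => bellman_mono subset_rfl subset_rfl ih

theorem valueWithin_le_value (n : ℕ) (x : S) : G.valueWithin A T D n x ≤ G.value A T D x :=
  le_iSup (fun n => G.valueWithin A T D n x) n

theorem valueWithin_le_one (n : ℕ) (x : S) : G.valueWithin A T D n x ≤ 1 := by
  induction n generalizing x with
  | zero => exact zero_le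
  | succ n ih => exact bellman_le_one ih x

theorem value_le_one (x : S) : G.value A T D x ≤ 1 :=
  iSup_le fun n => valueWithin_le_one n x

theorem value_ne_top (x : S) : G.value A T D x ≠ ∞ :=
  ((value_le_one x).trans_lt ENNReal.one_lt_top).ne

theorem value_mono (hAB : ∀ x, A x ⊆ B x) (hED : E ⊆ D) (x : S) :
    G.value A T D x ≤ G.value B T E x := by
  refine iSup_mono fun n => ?_
  induction n generalizing x with
  | zero => exact le_rfl
  | succ n ih => exact bellman_mono (hAB x) hED ih

theorem value_le_bellman (x : S) : G.value A T D x ≤ G.bellman A T D (G.value A T D) x :=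
  iSup_le fun n => (valueWithin_monotone n.le_succ x).trans
    (bellman_mono subset_rfl subset_rfl (valueWithin_le_value n))

theorem bellman_value (hG : G.FinitelyBranching) (x : S) :
    G.bellman A T D (G.value A T D) x = G.value A T D x := by
  refine le_antisymm ((bellman_iSup hG valueWithin_monotone x).trans_le ?_) (value_le_bellman x)
  exact iSup_le fun n => valueWithin_le_value (n + 1) x

theorem value_of_mem_target (hG : G.FinitelyBranching) (hx : x ∈ T) : G.value A T D x = 1 :=
  (bellman_value hG x).symm.trans (bellman_of_mem_target hx)

theorem value_max (hG : G.FinitelyBranching) (hx : x ∉ T ∪ D) (h : G.kind x = .maximizer) :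
    G.value A T D x = ⨆ y ∈ A x, G.value A T D y :=
  (bellman_value hG x).symm.trans (bellman_max hx h)

theorem value_min (hG : G.FinitelyBranching) (hx : x ∉ T ∪ D) (h : G.kind x = .minimizer) :
    G.value A T D x = ⨅ y ∈ G.successors x, G.value A T D y :=
  (bellman_value hG x).symm.trans (bellman_min hx h)

theorem value_random (hG : G.FinitelyBranching) (hx : x ∉ T ∪ D) (h : G.kind x = .random) :
    G.value A T D x = expectation (G.prob ⟨x, h⟩) (G.value A T D) :=
  (bellman_value hG x).symm.trans (bellman_random hx h)

theorem value_of_mem_dead (hG : G.FinitelyBranching) (hT : x ∉ T) (hD : x ∈ D) :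
    G.value A T D x = 0 := by
  rw [← bellman_value hG, bellman_of_terminal (Or.inr hD), Set.indicator_of_notMem hT]

theorem value_le_of_mem (hG : G.FinitelyBranching) (hx : x ∉ D) (h : G.kind x = .maximizer)
    {y : S} (hy : y ∈ A x) : G.value A T D y ≤ G.value A T D x := by
  by_cases hT : x ∈ T
  · rw [value_of_mem_target hG hT]
    exact value_le_one y
  · rw [value_max hG (fun hTD => hTD.elim hT hx) h]
    exact le_iSup₂ (f := fun y _ => G.value A T D y) y hy

theorem value_le_of_mem_successors (hG : G.FinitelyBranching) (hx : x ∉ T ∪ D)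
    (h : G.kind x = .minimizer) {y : S} (hy : y ∈ G.successors x) :
    G.value A T D x ≤ G.value A T D y := by
  rw [value_min hG hx h]
  exact iInf₂_le y hy

theorem le_value_of_le_mul_bellman {γ : ℝ≥0∞} (hγ : γ < 1) (hg1 : ∀ x, g x ≤ 1)
    (hg : ∀ x, g x ≤ γ * G.bellman A T D g x) (x : S) : g x ≤ G.value A T D x := by
  have approx : ∀ n x, g x ≤ G.valueWithin A T D n x + γ ^ n := by
    intro n
    induction n with
    | zero => simpa [valueWithin_zero] using hg1
    | succ n ih =>
      intro x
      calc g x ≤ γ * G.bellman A T D g x := hg x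
        _ ≤ γ * G.bellman A T D (fun y => G.valueWithin A T D n y + γ ^ n) x :=
          mul_le_mul_right (bellman_mono subset_rfl subset_rfl ih) γ
        _ ≤ γ * (G.valueWithin A T D (n + 1) x + γ ^ n) :=
          mul_le_mul_right (bellman_add_const_le _ _ x) γ
        _ ≤ G.valueWithin A T D (n + 1) x + γ ^ (n + 1) := by
          rw [mul_add, ← pow_succ']
          gcongr
          exact mul_le_of_le_one_left' hγ.le
  have lim : Filter.Tendsto (fun n => G.value A T D x + γ ^ n) Filter.atTop
      (nhds (G.value A T D x)) := by
    simpa using (ENNReal.tendsto_pow_atTop_nhds_zero_of_lt_one hγ).const_add (G.value A T D x)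
  refine ge_of_tendsto' lim fun n => (approx n x).trans ?_
  gcongr
  exact valueWithin_le_value n x

-- Once a multiple of `w` is guaranteed everywhere, it is guaranteed again after any number of
-- steps, at no cost since the moves in `A` keep `w` unchanged. This bounds
-- `c * w + (1 - c) * value` by `value`, and the second summand cancels.
theorem le_value_of_mul_le (hG : G.FinitelyBranching) (hw : ∀ x, w x ≤ G.bellman B T D w x)
    (hA : ∀ x, (A x).Nonempty)
    (hAw : ∀ x ∉ T ∪ D, G.kind x = .maximizer → ∀ y ∈ A x, w y = w x)
    {c : ℝ≥0∞} (hc0 : c ≠ 0) (hc1 : c ≤ 1) (h : ∀ x, c * w x ≤ G.value A T D x) (x : S) :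
    w x ≤ G.value A T D x := by
  have hc : c + (1 - c) = 1 := add_tsub_cancel_of_le hc1
  have mix : ∀ n x, c * w x + (1 - c) * G.valueWithin A T D n x ≤ G.value A T D x := by
    intro n
    induction n with
    | zero => simpa [valueWithin_zero] using h
    | succ n ih =>
      intro x
      rw [valueWithin_succ, ← bellman_value hG]
      exact (mul_add_mul_bellman_le hc (hw x) (hA x) (hAw x) _).trans
        (bellman_mono subset_rfl subset_rfl ih)
  have mix_value : c * w x + (1 - c) * G.value A T D x ≤
      c * G.value A T D x + (1 - c) * G.value A T D x := by
    rw [← add_mul, hc, one_mul]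
    nth_rw 1 [value]
    rw [ENNReal.mul_iSup, ENNReal.add_iSup]
    exact iSup_le fun n => mix n x
  have hfin : (1 - c) * G.value A T D x ≠ ∞ :=
    ENNReal.mul_ne_top (ENNReal.sub_ne_top ENNReal.one_ne_top) (value_ne_top x)
  exact (ENNReal.mul_le_mul_iff_right hc0 (hc1.trans_lt ENNReal.one_lt_top).ne).1
    ((ENNReal.add_le_add_iff_right hfin).1 mix_value)

theorem mul_value_le_of_compl_subset (hG : G.FinitelyBranching) {F : Set S}
    (hBA : ∀ x ∉ F, B x ⊆ A x) {c : ℝ≥0∞} (hc1 : c ≤ 1)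
    (h : ∀ x ∈ F, c * G.value B T D x ≤ G.value A T D x) (x : S) :
    c * G.value B T D x ≤ G.value A T D x := by
  rw [value, ENNReal.mul_iSup]
  refine iSup_le fun n => ?_
  induction n generalizing x with
  | zero => simp [valueWithin_zero]
  | succ n ih =>
    by_cases hx : x ∈ F
    · exact (mul_le_mul_right (valueWithin_le_value (n + 1) x) c).trans (h x hx)
    calc c * G.valueWithin B T D (n + 1) x
        ≤ G.bellman B T D (fun y => c * G.valueWithin B T D n y) x := mul_bellman_le hc1 _ x
      _ ≤ G.bellman A T D (G.value A T D) x := bellman_mono (hBA x hx) subset_rfl ih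
      _ = G.value A T D x := bellman_value hG x

theorem exists_finite_valueWithin_congr (hG : G.FinitelyBranching) (T D : Set S) (n : ℕ) (s : S) :
    ∃ F : Set S, F.Finite ∧ s ∈ F ∧ ∀ A B : S → Set S, (∀ x, A x ⊆ G.successors x) →
      (∀ x ∈ F, A x = B x) → G.valueWithin A T D n s = G.valueWithin B T D n s := by
  induction n generalizing s with
  | zero => exact ⟨{s}, Set.finite_singleton s, rfl, fun _ _ _ _ => rfl⟩
  | succ n ih =>
    choose F hF _ hcongr using ih
    refine ⟨{s} ∪ ⋃ y ∈ G.successors s, F y,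
      (Set.finite_singleton s).union ((hG s).biUnion fun y _ => hF y), Or.inl rfl, ?_⟩
    intro A B hA hAB
    exact bellman_congr (hA s) (hAB s (Or.inl rfl)) fun y hy =>
      hcongr y A B hA fun x hx => hAB x (Or.inr (Set.mem_biUnion hy hx))

theorem exists_lt_pow_mul_valueWithin {t : ℝ≥0∞} (ht : t < G.value A T D x) :
    ∃ γ : ℝ≥0∞, 0 < γ ∧ γ < 1 ∧ ∃ n, t < γ ^ n * G.valueWithin A T D n x := by
  obtain ⟨n, hn⟩ := lt_iSup_iff.1 ht
  have hcont : Filter.Tendsto (fun γ : ℝ≥0∞ => γ ^ n * G.valueWithin A T D n x)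
      (nhdsWithin 1 (Set.Iio 1)) (nhds (1 ^ n * G.valueWithin A T D n x)) :=
    (ENNReal.Tendsto.mul_const ((ENNReal.continuous_pow n).tendsto 1) (Or.inl (by simp))).mono_left
      nhdsWithin_le_nhds
  have hlt := hcont.eventually_const_lt (by simpa using hn)
  have hpos : ∀ᶠ γ : ℝ≥0∞ in nhdsWithin 1 (Set.Iio 1), 0 < γ :=
    nhdsWithin_le_nhds (lt_mem_nhds one_pos)
  have : (nhdsWithin (1 : ℝ≥0∞) (Set.Iio 1)).NeBot := nhdsLT_neBot_of_exists_lt ⟨0, one_pos⟩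
  obtain ⟨γ, ⟨hγt, hγ0⟩, hγ1⟩ := ((hlt.and hpos).and self_mem_nhdsWithin).exists
  exact ⟨γ, hγ0, hγ1, n, hγt⟩

end Value

section Selectors

variable {S : Type*} {G : StochasticGame S} {A : S → Set S} {T D : Set S} {x : S}

/-- `A` restricts the moves of the maximizer to at least one successor of each state. -/
structure IsRestriction (G : StochasticGame S) (A : S → Set S) : Prop where
  nonempty : ∀ x, (A x).Nonempty
  subset : ∀ x, A x ⊆ G.successors x

/-- A successor of every state. Restricted to the states of one player, it is an MD strategy of
this player. -/
structure Selector (G : StochasticGame S) where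
  toFun : S → S
  step : ∀ x, G.step x (toFun x)

instance : CoeFun G.Selector fun _ => S → S := ⟨Selector.toFun⟩

/-- The restriction of the moves to those chosen by a selector. -/
def Selector.moves (f : G.Selector) (x : S) : Set S := {f x}

theorem Selector.isRestriction_moves (f : G.Selector) : G.IsRestriction f.moves where
  nonempty x := Set.singleton_nonempty (f x)
  subset x := Set.singleton_subset_iff.2 (f.step x)

theorem isRestriction_successors (G : StochasticGame S) : G.IsRestriction G.successors where
  nonempty := successors_nonempty
  subset _ := subset_rfl

theorem IsRestriction.exists_selector (hA : G.IsRestriction A) :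
    ∃ f : G.Selector, ∀ x, f x ∈ A x := by
  choose f hf using hA.nonempty
  exact ⟨⟨f, fun x => hA.subset x (hf x)⟩, hf⟩

/-- The moves in `A` that are best for the payoff `u` at the next state. -/
def greedyMoves (A : S → Set S) (u : S → ℝ≥0∞) (x : S) : Set S := {y ∈ A x | IsMaxOn u (A x) y}

theorem greedyMoves_subset (A : S → Set S) (u : S → ℝ≥0∞) (x : S) : greedyMoves A u x ⊆ A x :=
  Set.sep_subset _ _

theorem IsRestriction.greedyMoves (hA : G.IsRestriction A) (hG : G.FinitelyBranching)
    (u : S → ℝ≥0∞) : G.IsRestriction (greedyMoves A u) where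
  nonempty x := Set.exists_max_image (A x) u ((hG x).subset (hA.subset x)) (hA.nonempty x)
  subset x := (greedyMoves_subset A u x).trans (hA.subset x)

theorem value_eq_of_mem_greedyMoves (hG : G.FinitelyBranching) (hx : x ∉ T ∪ D)
    (hk : G.kind x = .maximizer) {y : S} (hy : y ∈ greedyMoves A (G.value A T D) x) :
    G.value A T D y = G.value A T D x := by
  refine (value_le_of_mem hG (fun hD => hx (Or.inr hD)) hk hy.1).antisymm ?_
  rw [value_max hG hx hk]
  exact iSup₂_le hy.2

theorem exists_selector_pow_mul_valueWithin_le (hG : G.FinitelyBranching)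
    (hA : G.IsRestriction A) (T D : Set S) {γ : ℝ≥0∞} (hγ : γ < 1) :
    ∃ f : G.Selector, (∀ x, f x ∈ A x) ∧
      ∀ n x, γ ^ n * G.valueWithin A T D n x ≤ G.value f.moves T D x := by
  set u : S → ℝ≥0∞ := fun x => ⨆ n, γ ^ n * G.valueWithin A T D n x
  have le_u : ∀ n x, γ ^ n * G.valueWithin A T D n x ≤ u x :=
    fun n x => le_iSup (fun n => γ ^ n * G.valueWithin A T D n x) n
  have u_le_one : ∀ x, u x ≤ 1 := fun x => iSup_le fun n =>
    mul_le_one' (pow_le_one' hγ.le n) (valueWithin_le_one n x)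
  have u_le_bellman : ∀ x, u x ≤ γ * G.bellman A T D u x := by
    refine fun x => iSup_le fun n => ?_
    cases n with
    | zero => simp [valueWithin_zero]
    | succ n =>
      rw [pow_succ', mul_assoc, valueWithin_succ]
      exact mul_le_mul_right ((mul_bellman_le (pow_le_one' hγ.le n) _ x).trans
        (bellman_mono subset_rfl subset_rfl (le_u n))) γ
  obtain ⟨f, hf⟩ := (hA.greedyMoves hG u).exists_selector
  refine ⟨f, fun x => (hf x).1, fun n x => (le_u n x).trans ?_⟩
  refine le_value_of_le_mul_bellman hγ u_le_one (fun x => (u_le_bellman x).trans ?_) x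
  refine mul_le_mul_right (bellman_le_bellman_of_forall_le fun _ _ y hy => ?_) γ
  exact ((hf x).2 hy).trans (le_iSup₂ (f := fun z _ => u z) (f x) (Set.mem_singleton (f x)))

theorem exists_selector_lt_value (hG : G.FinitelyBranching) (hA : G.IsRestriction A)
    {t : ℝ≥0∞} (ht : t < G.value A T D x) :
    ∃ f : G.Selector, (∀ y, f y ∈ A y) ∧ t < G.value f.moves T D x ∧
      ∀ y, 0 < G.value A T D y → 0 < G.value f.moves T D y := by
  obtain ⟨γ, hγ0, hγ1, n, hn⟩ := exists_lt_pow_mul_valueWithin ht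
  obtain ⟨f, hfA, hf⟩ := exists_selector_pow_mul_valueWithin_le hG hA T D hγ1
  refine ⟨f, hfA, hn.trans_le (hf n x), fun y hy => ?_⟩
  obtain ⟨m, hm⟩ := lt_iSup_iff.1 hy
  exact (ENNReal.mul_pos (ENNReal.pow_pos hγ0 m).ne' hm.ne').trans_le (hf m y)

theorem exists_selector_half_value_le (hG : G.FinitelyBranching) (hA : G.IsRestriction A)
    (T D : Set S) (s : S) :
    ∃ f : G.Selector, (∀ x, f x ∈ A x) ∧
      (∃ n, 2⁻¹ * G.value A T D s ≤ G.valueWithin f.moves T D n s) ∧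
      ∀ x, 0 < G.value A T D x → 0 < G.value f.moves T D x := by
  by_cases hzero : ∀ x, G.value A T D x = 0
  · obtain ⟨f, hf⟩ := hA.exists_selector
    exact ⟨f, hf, ⟨0, by simp [hzero s]⟩, fun x hx => absurd (hzero x) hx.ne'⟩
  by_cases hs : G.value A T D s = 0
  · obtain ⟨z, hz⟩ := not_forall.1 hzero
    obtain ⟨f, hfA, -, hpos⟩ := exists_selector_lt_value hG hA (pos_iff_ne_zero.2 hz)
    exact ⟨f, hfA, ⟨0, by simp [hs]⟩, hpos⟩
  · have hlt : 2⁻¹ * G.value A T D s < G.value A T D s := by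
      rw [mul_comm, ← div_eq_mul_inv]
      exact ENNReal.half_lt_self hs (value_ne_top s)
    obtain ⟨f, hfA, hfs, hpos⟩ := exists_selector_lt_value hG hA hlt
    obtain ⟨n, hn⟩ := lt_iSup_iff.1 hfs
    exact ⟨f, hfA, ⟨n, hn.le⟩, hpos⟩

theorem exists_pos_mul_le_of_finite {α : Type*} {F : Set α} (hF : F.Finite) {u w : α → ℝ≥0∞}
    (hw : ∀ x, w x ≤ 1) (hpos : ∀ x ∈ F, 0 < w x → 0 < u x) :
    ∃ c : ℝ≥0∞, c ≠ 0 ∧ c ≤ 1 ∧ ∀ x ∈ F, c * w x ≤ u x := by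
  induction F, hF using Set.Finite.induction_on with
  | empty => exact ⟨1, by simp⟩
  | @insert a F _ _ ih =>
    obtain ⟨c, hc0, hc1, hc⟩ := ih fun x hx => hpos x (Or.inr hx)
    rcases eq_or_ne (w a) 0 with hwa | hwa
    · exact ⟨c, hc0, hc1, Set.forall_mem_insert.2 ⟨by simp [hwa], hc⟩⟩
    have hua : 0 < u a := hpos a (Or.inl rfl) (pos_iff_ne_zero.2 hwa)
    refine ⟨min c (u a), (lt_min (pos_iff_ne_zero.2 hc0) hua).ne', (min_le_left _ _).trans hc1,
      Set.forall_mem_insert.2 ⟨?_, fun x hx => ?_⟩⟩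
    · exact (mul_le_of_le_one_right' (hw a)).trans (min_le_right _ _)
    · exact (mul_le_mul_left (min_le_left _ _) _).trans (hc x hx)

/-- The moves in `A` that agree with the selector `f` on the set `F`. -/
def fixOn (A : S → Set S) (F : Set S) (f : G.Selector) (x : S) : Set S :=
  {y ∈ A x | x ∈ F → y = f x}

theorem fixOn_subset (A : S → Set S) (F : Set S) (f : G.Selector) (x : S) :
    fixOn A F f x ⊆ A x := Set.sep_subset _ _

theorem fixOn_of_mem {F : Set S} {f : G.Selector} (hf : f x ∈ A x) (hx : x ∈ F) :
    fixOn A F f x = f.moves x :=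
  Set.Subset.antisymm (fun _ hy => hy.2 hx) (Set.singleton_subset_iff.2 ⟨hf, fun _ => rfl⟩)

theorem IsRestriction.fixOn (hA : G.IsRestriction A) (F : Set S) {f : G.Selector}
    (hf : ∀ x, f x ∈ A x) : G.IsRestriction (fixOn A F f) where
  nonempty x := ⟨f x, hf x, fun _ => rfl⟩
  subset x := (fixOn_subset A F f x).trans (hA.subset x)

/-- The moves in `A` do not change the value that the maximizer can achieve with them. -/
def PreservesValue (G : StochasticGame S) (A : S → Set S) (T D : Set S) : Prop :=
  ∀ x ∉ T ∪ D, G.kind x = .maximizer → ∀ y ∈ A x, G.value A T D y = G.value A T D x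

theorem value_fixOn_eq (hG : G.FinitelyBranching) (hA : G.IsRestriction A)
    (hAv : G.PreservesValue A T D) {F : Set S} (hF : F.Finite) {f : G.Selector}
    (hfA : ∀ x, f x ∈ A x) (hpos : ∀ x, 0 < G.value A T D x → 0 < G.value f.moves T D x) (x : S) :
    G.value (fixOn A F f) T D x = G.value A T D x := by
  have le_fixOn : ∀ x, G.value f.moves T D x ≤ G.value (fixOn A F f) T D x :=
    value_mono (fun x => Set.singleton_subset_iff.2 ⟨hfA x, fun _ => rfl⟩) subset_rfl
  obtain ⟨c, hc0, hc1, hc⟩ := exists_pos_mul_le_of_finite hF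
    (u := G.value (fixOn A F f) T D) (w := G.value A T D) value_le_one
    fun x _ hx => (hpos x hx).trans_le (le_fixOn x)
  refine le_antisymm (value_mono (fixOn_subset A F f) subset_rfl x) ?_
  refine le_value_of_mul_le hG value_le_bellman (hA.fixOn F hfA).nonempty
    (fun x hx hk y hy => hAv x hx hk y hy.1) hc0 hc1 (fun z => ?_) x
  refine mul_value_le_of_compl_subset hG (fun x hx => ?_) hc1 hc z
  exact fun y hy => ⟨hy, fun h => absurd h hx⟩

/-- A restriction of the moves in `A` that loses no value and leaves a single move at the states in
`committed`. -/
structure Commitment (G : StochasticGame S) (A : S → Set S) (T D : Set S) where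
  moves : S → Set S
  isRestriction : G.IsRestriction moves
  moves_subset : ∀ x, moves x ⊆ A x
  value_eq : ∀ x, G.value moves T D x = G.value A T D x
  committed : Set S
  subsingleton : ∀ x ∈ committed, (moves x).Subsingleton

namespace Commitment

instance : Preorder (G.Commitment A T D) where
  le P Q := P.committed ⊆ Q.committed ∧ ∀ x ∈ P.committed, Q.moves x = P.moves x
  le_refl _ := ⟨subset_rfl, fun _ _ => rfl⟩
  le_trans _ _ _ hPQ hQR :=
    ⟨hPQ.1.trans hQR.1, fun x hx => (hQR.2 x (hPQ.1 hx)).trans (hPQ.2 x hx)⟩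

theorem exists_extension (hG : G.FinitelyBranching) (hAv : G.PreservesValue A T D)
    (P : G.Commitment A T D) (s : S) :
    ∃ Q, P ≤ Q ∧ s ∈ Q.committed ∧ ∀ B : S → Set S, (∀ x ∈ Q.committed, B x = Q.moves x) →
      2⁻¹ * G.value A T D s ≤ G.value B T D s := by
  have hPv : G.PreservesValue P.moves T D := fun x hx hk y hy => by
    rw [P.value_eq, P.value_eq, hAv x hx hk y (P.moves_subset x hy)]
  obtain ⟨f, hfP, ⟨n, hn⟩, hpos⟩ := exists_selector_half_value_le hG P.isRestriction T D s
  obtain ⟨F, hF, hsF, hcongr⟩ := exists_finite_valueWithin_congr hG T D n s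
  refine ⟨{
      moves := fixOn P.moves F f
      isRestriction := P.isRestriction.fixOn F hfP
      moves_subset := fun x => (fixOn_subset _ F f x).trans (P.moves_subset x)
      value_eq := fun x =>
        (value_fixOn_eq hG P.isRestriction hPv hF hfP hpos x).trans (P.value_eq x)
      committed := P.committed ∪ F
      subsingleton := ?_ }, ⟨Set.subset_union_left, fun x hx => ?_⟩, Or.inr hsF, fun B hB => ?_⟩
  · rintro x (hx | hx)
    · exact (P.subsingleton x hx).anti (fixOn_subset _ F f x)
    · exact fixOn_of_mem (hfP x) hx ▸ Set.subsingleton_singleton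
  · refine (fixOn_subset _ F f x).antisymm fun y hy => ?_
    exact ⟨hy, fun _ => P.subsingleton x hx hy (hfP x)⟩
  · have hfB : ∀ x ∈ F, f.moves x = B x := fun x hx =>
      ((hB x (Or.inr hx)).trans (fixOn_of_mem (hfP x) hx)).symm
    rw [← P.value_eq]
    rw [hcongr f.moves B f.isRestriction_moves.subset hfB] at hn
    exact hn.trans (valueWithin_le_value n s)

theorem exists_selector_moves_eq {P : ℕ → G.Commitment A T D} (hP : Monotone P)
    (hcover : ∀ x, ∃ n, x ∈ (P n).committed) :
    ∃ f : G.Selector, ∀ n, ∀ x ∈ (P n).committed, f.moves x = (P n).moves x := by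
  choose N hN using hcover
  choose f hf using fun x => (P (N x)).isRestriction.nonempty x
  refine ⟨⟨f, fun x => (P (N x)).isRestriction.subset x (hf x)⟩, fun n x hx => ?_⟩
  have hfx : f x ∈ (P n).moves x := by
    rcases le_total n (N x) with h | h
    · exact (hP h).2 x hx ▸ hf x
    · exact (hP h).2 x (hN x) ▸ hf x
  exact (((P n).subsingleton x hx).eq_singleton_of_mem hfx).symm

end Commitment

-- Commit to moves at one state after the other: each commitment alone secures half of the value at
-- its state, hence so does their union `f` at every state, and `le_value_of_mul_le` removes the
-- factor `1 / 2`.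
theorem exists_selector_forall_value_le [Countable S] (hG : G.FinitelyBranching)
    (hA : G.IsRestriction A) (hAv : G.PreservesValue A T D) :
    ∃ f : G.Selector, ∀ x, G.value A T D x ≤ G.value f.moves T D x := by
  rcases isEmpty_or_nonempty S with hS | hS
  · exact ⟨⟨id, isEmptyElim⟩, isEmptyElim⟩
  obtain ⟨e, he⟩ := exists_surjective_nat S
  choose next hle hmem hhalf using fun P : G.Commitment A T D => P.exists_extension hG hAv
  let P : ℕ → G.Commitment A T D := fun n =>
    n.rec ⟨A, hA, fun _ => subset_rfl, fun _ => rfl, ∅, by simp⟩ fun n Q => next Q (e n)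
  have hP : Monotone P := monotone_nat_of_le_succ fun n => hle (P n) (e n)
  have hcover : ∀ x, ∃ n, x ∈ (P n).committed := fun x => by
    obtain ⟨n, rfl⟩ := he x
    exact ⟨n + 1, hmem (P n) (e n)⟩
  obtain ⟨f, hf⟩ := Commitment.exists_selector_moves_eq hP hcover
  have hfA : ∀ x, f x ∈ A x := fun x => by
    obtain ⟨n, hn⟩ := hcover x
    exact (P n).moves_subset x (hf n x hn ▸ Set.mem_singleton (f x))
  refine ⟨f, le_value_of_mul_le (c := 2⁻¹) hG value_le_bellman f.isRestriction_moves.nonempty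
    ?_ (by simp) (by simp) fun x => ?_⟩
  · rintro x hx hk _ rfl
    exact hAv x hx hk (f x) (hfA x)
  · obtain ⟨n, rfl⟩ := he x
    exact hhalf (P n) (e n) f.moves (hf (n + 1))

theorem value_greedyMoves (hG : G.FinitelyBranching)
    (h : ∀ x ∉ T ∪ D, G.kind x = .maximizer → ∀ y ∈ A x,
      G.value A T D y = 0 ∨ G.value A T D y = G.value A T D x) (x : S) :
    G.value (greedyMoves A (G.value A T D)) T D x = G.value A T D x := by
  refine (value_mono (greedyMoves_subset A _) subset_rfl x).antisymm (iSup_mono fun n => ?_)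
  induction n generalizing x with
  | zero => exact le_rfl
  | succ n ih =>
    refine (bellman_le_bellman_of_forall_le fun hx hk y hy => ?_).trans
      (bellman_mono subset_rfl subset_rfl ih)
    rcases h x hx hk y hy with hy0 | hyx
    · exact (valueWithin_le_value n y).trans (hy0.trans_le zero_le)
    · refine le_iSup₂ (f := fun y _ => G.valueWithin A T D n y) y ⟨hy, fun z hz => ?_⟩
      exact (value_le_of_mem hG (fun hD => hx (Or.inr hD)) hk hz).trans_eq hyx.symm

theorem exists_selector_forall_value_le_of_eq_zero_or_eq [Countable S] (hG : G.FinitelyBranching)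
    (hA : G.IsRestriction A)
    (h : ∀ x ∉ T ∪ D, G.kind x = .maximizer → ∀ y ∈ A x,
      G.value A T D y = 0 ∨ G.value A T D y = G.value A T D x) :
    ∃ f : G.Selector, ∀ x, G.value A T D x ≤ G.value f.moves T D x := by
  obtain ⟨f, hf⟩ := exists_selector_forall_value_le (T := T) (D := D) hG
    (hA.greedyMoves hG (G.value A T D)) fun x hx hk y hy => by
      rw [value_greedyMoves hG h, value_greedyMoves hG h, value_eq_of_mem_greedyMoves hG hx hk hy]
  exact ⟨f, fun x => (value_greedyMoves hG h x).symm.trans_le (hf x)⟩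

end Selectors

section Hitting

variable {S : Type*} {G : StochasticGame S} {T : Set S} {σ : G.MaxStrategy} {π : G.MinStrategy}
  {s : S}

open Classical in
/-- The probability that `T` is visited before `n` more states have been seen, when the play has
passed through `w` and is now in the given state. -/
noncomputable def hitWithin (G : StochasticGame S) (T : Set S) (σ : G.MaxStrategy)
    (π : G.MinStrategy) : ℕ → List S → S → ℝ≥0∞
  | 0, _, _ => 0
  | n + 1, w, s =>
    if s ∈ T then 1 else expectation (G.nextDist σ π w s) (hitWithin G T σ π n (w ++ [s]))

theorem hitWithin_succ_of_mem (n : ℕ) (w : List S) (hs : s ∈ T) :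
    G.hitWithin T σ π (n + 1) w s = 1 := if_pos hs

theorem hitWithin_succ_of_notMem (n : ℕ) (w : List S) (hs : s ∉ T) :
    G.hitWithin T σ π (n + 1) w s =
      expectation (G.nextDist σ π w s) (G.hitWithin T σ π n (w ++ [s])) := if_neg hs

/-- The probability that `T` is visited when the play has passed through `w` and is now in `s`. -/
noncomputable def hitProb (G : StochasticGame S) (T : Set S) (σ : G.MaxStrategy)
    (π : G.MinStrategy) (w : List S) (s : S) : ℝ≥0∞ :=
  ⨆ n, G.hitWithin T σ π n w s

theorem hitProb_le_expectation (w : List S) (hs : s ∉ T) :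
    G.hitProb T σ π w s ≤ expectation (G.nextDist σ π w s) (G.hitProb T σ π (w ++ [s])) := by
  refine iSup_le fun n => ?_
  cases n with
  | zero => exact zero_le
  | succ n =>
    rw [hitWithin_succ_of_notMem n w hs]
    exact expectation_mono fun y _ => le_iSup (fun n => G.hitWithin T σ π n (w ++ [s]) y) n

open Classical in
/-- The probability that `T` has been visited in `w` or will be visited before `n` more states have
been seen. -/
noncomputable def hitByTime (G : StochasticGame S) (T : Set S) (σ : G.MaxStrategy)
    (π : G.MinStrategy) (n : ℕ) (w : List S) (s : S) : ℝ≥0∞ :=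
  if ∃ t ∈ w, t ∈ T then 1 else G.hitWithin T σ π n w s

theorem expectation_hitByTime (n : ℕ) (w : List S) (s : S) :
    expectation (G.nextDist σ π w s) (G.hitByTime T σ π n (w ++ [s])) =
      G.hitByTime T σ π (n + 1) w s := by
  unfold hitByTime
  by_cases hw : ∃ t ∈ w, t ∈ T
  · have hws : ∃ t ∈ w ++ [s], t ∈ T := hw.imp fun t ht => ⟨List.mem_append_left _ ht.1, ht.2⟩
    simp only [if_pos hw, if_pos hws, expectation_const]
  by_cases hs : s ∈ T
  · have hws : ∃ t ∈ w ++ [s], t ∈ T := ⟨s, by simp, hs⟩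
    simp only [if_neg hw, if_pos hws, expectation_const, hitWithin_succ_of_mem n w hs]
  · have hws : ¬ ∃ t ∈ w ++ [s], t ∈ T := by
      simpa [or_imp, forall_and, hs] using hw
    simp only [if_neg hw, if_neg hws, hitWithin_succ_of_notMem n w hs]

/-- The states of a play before time `k`, oldest first. -/
def past (ω : ℕ → S) (k : ℕ) : List S := List.ofFn fun i : Fin k => ω i

theorem exists_mem_past_iff {ω : ℕ → S} {k : ℕ} : (∃ t ∈ past ω k, t ∈ T) ↔ ∃ i < k, ω i ∈ T := by
  simp [past, List.mem_ofFn, Fin.exists_iff]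

theorem earlier_eq_append {k : ℕ} {h : (i : Finset.Iic k) → S} {z : (i : Finset.Iic (k + 1)) → S}
    (hz : ∀ i (hi : i ≤ k), z ⟨i, Finset.mem_Iic.2 (hi.trans k.le_succ)⟩ =
      h ⟨i, Finset.mem_Iic.2 hi⟩) : earlier z = earlier h ++ [current h] := by
  rw [earlier, List.ofFn_succ', List.concat_eq_append]
  congr 2
  · exact funext fun i => hz i i.2.le
  · exact hz k le_rfl

variable [Countable S] [MeasurableSpace S] [DiscreteMeasurableSpace S]

theorem playMeasure_map_frestrictLe (s : S) (k : ℕ) :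
    (G.playMeasure s σ π).map (Preorder.frestrictLe k) =
      Kernel.partialTraj (X := fun _ => S) (G.stepKernel σ π) 0 k (fun _ => s) :=
  Kernel.traj_map_frestrictLe_apply (X := fun _ => S) (κ := G.stepKernel σ π) 0 k (fun _ => s)

theorem lintegral_past_current (s : S) (k : ℕ) (φ : List S → S → ℝ≥0∞) :
    ∫⁻ ω, φ (past ω k) (ω k) ∂G.playMeasure s σ π =
      ∫⁻ h, φ (earlier h) (current h)
        ∂Kernel.partialTraj (X := fun _ => S) (G.stepKernel σ π) 0 k (fun _ => s) := by
  rw [← playMeasure_map_frestrictLe, lintegral_map Measurable.of_discrete (by fun_prop)]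
  rfl

theorem lintegral_past_zero (s : S) (φ : List S → S → ℝ≥0∞) :
    ∫⁻ ω, φ (past ω 0) (ω 0) ∂G.playMeasure s σ π = φ [] s := by
  rw [lintegral_past_current, Kernel.partialTraj_self, Kernel.id_apply, lintegral_dirac]
  rfl

theorem lintegral_partialTraj_succ (k : ℕ) (h : (i : Finset.Iic k) → S) (φ : List S → S → ℝ≥0∞) :
    ∫⁻ z, φ (earlier z) (current z)
        ∂Kernel.partialTraj (X := fun _ => S) (G.stepKernel σ π) k (k + 1) h =
      expectation (G.nextDist σ π (earlier h) (current h))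
        (φ (earlier h ++ [current h])) := by
  rw [Kernel.partialTraj_succ_self, Kernel.lintegral_map _ (by fun_prop) _ Measurable.of_discrete,
    Kernel.lintegral_id_prod Measurable.of_discrete,
    Kernel.lintegral_map _ (by fun_prop) _ Measurable.of_discrete]
  refine (lintegral_toMeasure _ _).trans (expectation_congr fun y _ => ?_)
  rw [earlier_eq_append (h := h) fun i hi => by simp [IicProdIoc, hi]]
  simp [IicProdIoc, current, MeasurableEquiv.piSingleton]

theorem lintegral_past_succ (s : S) (k : ℕ) (φ : List S → S → ℝ≥0∞) :
    ∫⁻ ω, φ (past ω (k + 1)) (ω (k + 1)) ∂G.playMeasure s σ π =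
      ∫⁻ ω, expectation (G.nextDist σ π (past ω k) (ω k)) (φ (past ω k ++ [ω k]))
        ∂G.playMeasure s σ π := by
  rw [lintegral_past_current, Kernel.partialTraj_succ_eq_comp (Nat.zero_le k),
    Kernel.lintegral_comp _ _ _ Measurable.of_discrete]
  simp only [lintegral_partialTraj_succ]
  exact (lintegral_past_current s k fun w x =>
    expectation (G.nextDist σ π w x) (φ (w ++ [x]))).symm

theorem lintegral_hitByTime (s : S) (n k : ℕ) :
    ∫⁻ ω, G.hitByTime T σ π n (past ω k) (ω k) ∂G.playMeasure s σ π =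
      G.hitWithin T σ π (n + k) [] s := by
  induction k generalizing n with
  | zero => exact (lintegral_past_zero s (G.hitByTime T σ π n)).trans (if_neg (by simp))
  | succ k ih =>
    rw [lintegral_past_succ]
    simp only [expectation_hitByTime, ih, Nat.add_right_comm, Nat.add_assoc]

theorem playMeasure_exists_lt (s : S) (n : ℕ) :
    G.playMeasure s σ π {ω | ∃ i < n, ω i ∈ T} = G.hitWithin T σ π n [] s := by
  have hmeas : MeasurableSet {ω : ℕ → S | ∃ i < n, ω i ∈ T} := by measurability
  rw [← lintegral_indicator_one hmeas, ← Nat.zero_add n, ← lintegral_hitByTime, Nat.zero_add]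
  classical
  refine lintegral_congr fun ω => ?_
  rw [Set.indicator_apply, hitByTime]
  exact if_congr exists_mem_past_iff.symm rfl rfl

theorem playMeasure_reach (s : S) :
    G.playMeasure s σ π (reach T) = G.hitProb T σ π [] s := by
  have hreach : reach T = ⋃ n, {ω : ℕ → S | ∃ i < n, ω i ∈ T} := by
    ext ω
    simp only [reach, Set.mem_ofPred_eq, Set.mem_iUnion]
    exact ⟨fun ⟨i, hi⟩ => ⟨i + 1, i, i.lt_succ_self, hi⟩, fun ⟨_, i, _, hi⟩ => ⟨i, hi⟩⟩
  have hmono : Monotone fun n => {ω : ℕ → S | ∃ i < n, ω i ∈ T} :=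
    fun m n hmn ω ⟨i, hi, h⟩ => ⟨i, hi.trans_le hmn, h⟩
  rw [hreach, hmono.measure_iUnion]
  exact iSup_congr fun n => playMeasure_exists_lt s n

end Hitting

section Strategies

variable {S : Type*} {G : StochasticGame S} {T D : Set S} {f : G.Selector}
  {σ : G.MaxStrategy} {π : G.MinStrategy} {w : List S} {s : S}

theorem nextDist_max (h : G.kind s = .maximizer) : G.nextDist σ π w s = σ.choice w ⟨s, h⟩ := by
  unfold nextDist
  split <;> first | rfl | next h' => cases h.symm.trans h'

theorem nextDist_min (h : G.kind s = .minimizer) : G.nextDist σ π w s = π.choice w ⟨s, h⟩ := by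
  unfold nextDist
  split <;> first | rfl | next h' => cases h.symm.trans h'

theorem nextDist_random (h : G.kind s = .random) : G.nextDist σ π w s = G.prob ⟨s, h⟩ := by
  unfold nextDist
  split <;> first | rfl | next h' => cases h.symm.trans h'

theorem support_nextDist_subset : (G.nextDist σ π w s).support ⊆ G.successors s := by
  cases h : G.kind s
  · rw [nextDist_max h]
    exact σ.step_of_mem_support w ⟨s, h⟩
  · rw [nextDist_min h]
    exact π.step_of_mem_support w ⟨s, h⟩
  · rw [nextDist_random h]
    exact G.step_of_mem_support ⟨s, h⟩

/-- The MD strategy that follows a selector. -/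
noncomputable def Selector.strategy (f : G.Selector) (k : StateKind) : G.Strategy k where
  choice _ s := PMF.pure (f s)
  step_of_mem_support _ s s' h := by
    rw [PMF.mem_support_pure_iff] at h
    exact h ▸ f.step s

theorem Selector.strategy_isMD (f : G.Selector) (k : StateKind) : (f.strategy k).IsMD :=
  ⟨fun s => f s, fun _ _ => rfl⟩

theorem bellman_moves_le_expectation (f : G.Selector) (π : G.MinStrategy) (w : List S) (hs : s ∉ T)
    (g : S → ℝ≥0∞) :
    G.bellman f.moves T D g s ≤ expectation (G.nextDist (f.strategy .maximizer) π w s) g := by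
  by_cases hD : s ∈ T ∪ D
  · rw [bellman_of_terminal hD, Set.indicator_of_notMem hs]
    exact zero_le
  cases h : G.kind s
  · rw [bellman_max hD h, nextDist_max h, Selector.strategy, expectation_pure, Selector.moves,
      iSup_singleton]
  · rw [bellman_min hD h]
    exact le_expectation fun y hy => iInf₂_le y (support_nextDist_subset hy)
  · rw [bellman_random hD h, nextDist_random h]

theorem valueWithin_le_hitWithin (f : G.Selector) (π : G.MinStrategy) (n : ℕ) (w : List S)
    (s : S) : G.valueWithin f.moves T D n s ≤ G.hitWithin T (f.strategy .maximizer) π n w s := by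
  induction n generalizing w s with
  | zero => exact zero_le
  | succ n ih =>
    by_cases hs : s ∈ T
    · rw [hitWithin_succ_of_mem n w hs]
      exact valueWithin_le_one (n + 1) s
    · rw [hitWithin_succ_of_notMem n w hs]
      exact (bellman_moves_le_expectation f π w hs _).trans (expectation_mono fun y _ => ih _ y)

theorem value_le_hitProb (f : G.Selector) (π : G.MinStrategy) (w : List S) (s : S) :
    G.value f.moves T D s ≤ G.hitProb T (f.strategy .maximizer) π w s :=
  iSup_mono fun n => valueWithin_le_hitWithin f π n w s

/-- The value of the game with the objective to reach `T`. -/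
noncomputable def reachValue (G : StochasticGame S) (T : Set S) : S → ℝ≥0∞ :=
  G.value G.successors T ∅

theorem reachValue_le_of_step (hG : G.FinitelyBranching) (h : G.kind s = .maximizer) {y : S}
    (hy : G.step s y) : G.reachValue T y ≤ G.reachValue T s :=
  value_le_of_mem hG (Set.notMem_empty s) h hy

theorem le_reachValue_of_step (hG : G.FinitelyBranching) (hs : s ∉ T) (h : G.kind s = .minimizer)
    {y : S} (hy : G.step s y) : G.reachValue T s ≤ G.reachValue T y :=
  value_le_of_mem_successors hG (by simpa using hs) h hy

theorem reachValue_random (hG : G.FinitelyBranching) (hs : s ∉ T) (h : G.kind s = .random) :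
    G.reachValue T s = expectation (G.prob ⟨s, h⟩) (G.reachValue T) :=
  value_random hG (by simpa using hs) h

theorem exists_selector_isMinOn (hG : G.FinitelyBranching) (u : S → S → ℝ≥0∞) :
    ∃ f : G.Selector, ∀ x, IsMinOn (u x) (G.successors x) (f x) := by
  choose f hf hmin using fun x =>
    Set.exists_min_image (G.successors x) (u x) (hG x) (successors_nonempty x)
  exact ⟨⟨f, hf⟩, hmin⟩

/-- The moves of the minimizer along `f` do not increase the value. -/
def IsValueOptimal (T : Set S) (f : G.Selector) : Prop :=
  ∀ x ∉ T, G.kind x = .minimizer → G.reachValue T (f x) ≤ G.reachValue T x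

theorem reachValue_le_of_isMinOn (hG : G.FinitelyBranching) (hs : s ∉ T)
    (h : G.kind s = .minimizer) (hf : IsMinOn (G.reachValue T) (G.successors s) (f s)) :
    G.reachValue T (f s) ≤ G.reachValue T s := by
  rw [reachValue, value_min hG (by simpa using hs) h]
  exact le_iInf₂ hf

theorem exists_isValueOptimal (hG : G.FinitelyBranching) (T : Set S) :
    ∃ f : G.Selector, IsValueOptimal T f := by
  obtain ⟨f, hf⟩ := exists_selector_isMinOn hG fun _ => G.reachValue T
  exact ⟨f, fun x hx h => reachValue_le_of_isMinOn hG hx h (hf x)⟩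

theorem IsValueOptimal.expectation_le (hf : IsValueOptimal T f) (hG : G.FinitelyBranching)
    (σ : G.MaxStrategy) (w : List S) (hs : s ∉ T) :
    expectation (G.nextDist σ (f.strategy .minimizer) w s) (G.reachValue T) ≤
      G.reachValue T s := by
  cases h : G.kind s
  · exact StochasticGame.expectation_le fun y hy =>
      reachValue_le_of_step hG h (support_nextDist_subset hy)
  · rw [nextDist_min h, Selector.strategy, expectation_pure]
    exact hf s hs h
  · rw [nextDist_random h, reachValue_random hG hs h]

theorem IsValueOptimal.hitProb_le (hf : IsValueOptimal T f) (hG : G.FinitelyBranching)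
    (σ : G.MaxStrategy) (w : List S) (s : S) :
    G.hitProb T σ (f.strategy .minimizer) w s ≤ G.reachValue T s := by
  refine iSup_le fun n => ?_
  induction n generalizing w s with
  | zero => exact zero_le
  | succ n ih =>
    by_cases hs : s ∈ T
    · rw [hitWithin_succ_of_mem n w hs, reachValue, value_of_mem_target hG hs]
    · rw [hitWithin_succ_of_notMem n w hs]
      exact (expectation_mono fun y _ => ih _ y).trans (hf.expectation_le hG σ w hs)

end Strategies

section Ranking

universe u

variable {S : Type u} (N : Set S →o Set S)

theorem mem_lfpApprox_iff {x : S} {a : Ordinal.{u}} :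
    x ∈ OrdinalApprox.lfpApprox N ⊥ a ↔ ∃ b < a, x ∈ N (OrdinalApprox.lfpApprox N ⊥ b) := by
  rw [OrdinalApprox.lfpApprox]
  simp

theorem exists_rank_lfp : ∃ ρ : S → Ordinal.{u}, ∀ a,
    N {x ∈ N.lfp | ρ x < a} = {x ∈ N.lfp | ρ x ≤ a} := by
  let stage : Ordinal.{u} → Set S := OrdinalApprox.lfpApprox N ⊥
  let ρ : S → Ordinal.{u} := fun x => sInf {a | x ∈ N (stage a)}
  have stage_le : ∀ a, stage a ≤ N.lfp :=
    OrdinalApprox.lfpApprox_le_of_mem_fixedPoints N N.map_lfp bot_le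
  have rank_le : ∀ {x a}, x ∈ N (stage a) → ρ x ≤ a := fun h => csInf_le' h
  have mem_rank : ∀ {x}, x ∈ N.lfp → x ∈ N (stage (ρ x)) := by
    intro x hx
    obtain ⟨a, ha⟩ := OrdinalApprox.lfp_mem_range_lfpApprox N
    obtain ⟨b, -, hb⟩ := (mem_lfpApprox_iff N).1 (ha ▸ hx)
    exact csInf_mem (s := {a | x ∈ N (stage a)}) ⟨b, hb⟩
  have stage_eq : ∀ a, {x ∈ N.lfp | ρ x < a} = stage a := by
    refine fun a => Set.Subset.antisymm (fun x hx => ?_) fun x hx => ?_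
    · exact (mem_lfpApprox_iff N).2 ⟨ρ x, hx.2, mem_rank hx.1⟩
    · obtain ⟨b, hb, hxb⟩ := (mem_lfpApprox_iff N).1 hx
      exact ⟨stage_le _ hx, (rank_le hxb).trans_lt hb⟩
  refine ⟨ρ, fun a => ?_⟩
  rw [stage_eq]
  refine Set.Subset.antisymm (fun x hx => ⟨?_, rank_le hx⟩) fun x hx => ?_
  · exact N.map_lfp ▸ N.mono (stage_le _) hx
  · exact N.mono (OrdinalApprox.lfpApprox_mono_right N hx.2) (mem_rank hx.1)

end Ranking

section Indifferent

variable {S : Type*} {G : StochasticGame S} {f : G.Selector} {T Z U : Set S} {σ : G.MaxStrategy}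
  {w : List S} {s : S}

/-- The moves to a successor of maximal value. -/
def optimalMoves (G : StochasticGame S) (T : Set S) : S → Set S :=
  greedyMoves G.successors (G.reachValue T)

theorem isRestriction_optimalMoves (hG : G.FinitelyBranching) (T : Set S) :
    G.IsRestriction (G.optimalMoves T) :=
  (isRestriction_successors G).greedyMoves hG (G.reachValue T)

theorem mem_optimalMoves (hG : G.FinitelyBranching) (h : G.kind s = .maximizer) {y : S}
    (hy : G.step s y) (hv : G.reachValue T y = G.reachValue T s) : y ∈ G.optimalMoves T s :=
  ⟨hy, fun _ hz => (reachValue_le_of_step hG h hz).trans_eq hv.symm⟩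

theorem reachValue_eq_of_mem_optimalMoves (hG : G.FinitelyBranching) (hs : s ∉ T)
    (h : G.kind s = .maximizer) {y : S} (hy : y ∈ G.optimalMoves T s) :
    G.reachValue T y = G.reachValue T s :=
  value_eq_of_mem_greedyMoves hG (by simpa using hs) h hy

/-- In `Z \ T` the moves of the minimizer do not change the value, and only value-decreasing moves
of the maximizer leave `Z`. -/
structure IsIndifferent (G : StochasticGame S) (T Z : Set S) : Prop where
  max : ∀ x ∈ Z, x ∉ T → G.kind x = .maximizer → G.optimalMoves T x ⊆ Z
  min : ∀ x ∈ Z, x ∉ T → G.kind x = .minimizer → ∀ y, G.step x y →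
    G.reachValue T y = G.reachValue T x ∧ y ∈ Z
  random : ∀ x ∈ Z, x ∉ T → ∀ h : G.kind x = .random, (G.prob ⟨x, h⟩).support ⊆ Z

theorem isIndifferent_value_one (hG : G.FinitelyBranching) (T : Set S) :
    G.IsIndifferent T {x | G.reachValue T x = 1} where
  max x hx hT h y hy := (reachValue_eq_of_mem_optimalMoves hG hT h hy).trans hx
  min x hx hT h y hy := by
    have hy1 : G.reachValue T y = 1 :=
      (value_le_one y).antisymm (hx.symm.trans_le (le_reachValue_of_step hG hT h hy))
    exact ⟨hy1.trans hx.symm, hy1⟩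
  random x hx hT h := by
    have mean_eq_one : expectation (G.prob ⟨x, h⟩) (G.reachValue T) = 1 :=
      (reachValue_random hG hT h).symm.trans hx
    exact eq_of_expectation_le (fun y _ => value_le_one y) (by simp [mean_eq_one])
      (by rw [mean_eq_one, expectation_const])

/-- The value if the maximizer may only use optimal moves and loses in `U` and outside `Z`. -/
noncomputable def optimalValue (G : StochasticGame S) (T Z U : Set S) : S → ℝ≥0∞ :=
  G.value (G.optimalMoves T) T (U ∪ Zᶜ)

theorem optimalValue_le_reachValue (x : S) : G.optimalValue T Z U x ≤ G.reachValue T x :=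
  value_mono (greedyMoves_subset _ _) (Set.empty_subset _) x

theorem hitProb_eq_of_mem_support (hG : G.FinitelyBranching) (hf : IsValueOptimal T f)
    (hs : s ∉ T) (heq : G.hitProb T σ (f.strategy .minimizer) w s = G.reachValue T s) :
    ∀ y ∈ (G.nextDist σ (f.strategy .minimizer) w s).support,
      G.hitProb T σ (f.strategy .minimizer) (w ++ [s]) y = G.reachValue T y := by
  have hle : ∀ y, G.hitProb T σ (f.strategy .minimizer) (w ++ [s]) y ≤ G.reachValue T y :=
    hf.hitProb_le hG σ (w ++ [s])
  have hmean := hf.expectation_le hG σ w hs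
  refine eq_of_expectation_le (fun y _ => hle y) ?_ ?_
  · exact ne_top_of_le_ne_top (value_ne_top s) ((expectation_mono fun y _ => hle y).trans hmean)
  · exact hmean.trans (heq.symm.trans_le (hitProb_le_expectation w hs))

theorem support_nextDist_subset_optimalMoves (hG : G.FinitelyBranching) (hf : IsValueOptimal T f)
    (hs : s ∉ T) (h : G.kind s = .maximizer)
    (heq : G.hitProb T σ (f.strategy .minimizer) w s = G.reachValue T s) :
    (G.nextDist σ (f.strategy .minimizer) w s).support ⊆ G.optimalMoves T s := by
  intro y hy
  refine mem_optimalMoves hG h (support_nextDist_subset hy) ?_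
  refine eq_of_expectation_le (g := fun _ => G.reachValue T s)
    (fun z hz => reachValue_le_of_step hG h (support_nextDist_subset hz))
    (ne_top_of_le_ne_top (value_ne_top s) (hf.expectation_le hG σ w hs)) ?_ y hy
  calc expectation _ (fun _ => G.reachValue T s)
      = G.hitProb T σ (f.strategy .minimizer) w s := by rw [expectation_const, heq]
    _ ≤ _ := hitProb_le_expectation w hs
    _ ≤ _ := expectation_mono fun z _ => hf.hitProb_le hG σ (w ++ [s]) z

theorem IsIndifferent.support_nextDist_subset (hZ : G.IsIndifferent T Z)
    (hG : G.FinitelyBranching) (hf : IsValueOptimal T f) (hsZ : s ∈ Z) (hs : s ∉ T)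
    (heq : G.hitProb T σ (f.strategy .minimizer) w s = G.reachValue T s) :
    (G.nextDist σ (f.strategy .minimizer) w s).support ⊆ Z := by
  cases h : G.kind s
  · exact (support_nextDist_subset_optimalMoves hG hf hs h heq).trans (hZ.max s hsZ hs h)
  · exact fun y hy => (hZ.min s hsZ hs h y (StochasticGame.support_nextDist_subset hy)).2
  · rw [nextDist_random h]
    exact hZ.random s hsZ hs h

theorem expectation_optimalValue_le (hG : G.FinitelyBranching) (hf : IsValueOptimal T f)
    (hs : s ∉ T ∪ (U ∪ Zᶜ))
    (hfs : G.kind s = .minimizer → G.optimalValue T Z U (f s) ≤ G.optimalValue T Z U s)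
    (heq : G.hitProb T σ (f.strategy .minimizer) w s = G.reachValue T s) :
    expectation (G.nextDist σ (f.strategy .minimizer) w s) (G.optimalValue T Z U) ≤
      G.optimalValue T Z U s := by
  have hsT : s ∉ T := fun h => hs (Or.inl h)
  cases h : G.kind s
  · exact expectation_le fun y hy => value_le_of_mem hG (fun hD => hs (Or.inr hD)) h
      (support_nextDist_subset_optimalMoves hG hf hsT h heq hy)
  · rw [nextDist_min h, Selector.strategy, expectation_pure]
    exact hfs h
  · rw [nextDist_random h]
    exact (value_random hG hs h).ge

-- A strategy that attains the value after a given past keeps attaining it, so it only uses optimal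
-- moves and never visits `U`.
theorem IsIndifferent.hitWithin_le_optimalValue (hZ : G.IsIndifferent T Z)
    (hG : G.FinitelyBranching) (hf : IsValueOptimal T f)
    (hU : ∀ y ∈ U, ∀ w, G.hitProb T σ (f.strategy .minimizer) w y < G.reachValue T y)
    (hfU : ∀ y ∉ T ∪ (U ∪ Zᶜ), G.kind y = .minimizer →
      G.optimalValue T Z U (f y) ≤ G.optimalValue T Z U y)
    (n : ℕ) (w : List S) {s : S} (hsZ : s ∈ Z)
    (heq : G.hitProb T σ (f.strategy .minimizer) w s = G.reachValue T s) :
    G.hitWithin T σ (f.strategy .minimizer) n w s ≤ G.optimalValue T Z U s := by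
  induction n generalizing w s with
  | zero => exact zero_le
  | succ n ih =>
    by_cases hs : s ∈ T
    · rw [hitWithin_succ_of_mem n w hs, optimalValue, value_of_mem_target hG hs]
    have hsU : s ∉ U := fun h => (hU s h w).ne heq
    have hsD : s ∉ T ∪ (U ∪ Zᶜ) := by simp [hs, hsU, hsZ]
    rw [hitWithin_succ_of_notMem n w hs]
    refine (expectation_mono fun y hy => ?_).trans
      (expectation_optimalValue_le hG hf hsD (hfU s hsD) heq)
    exact ih (w ++ [s]) (hZ.support_nextDist_subset hG hf hsZ hs heq hy)
      (hitProb_eq_of_mem_support hG hf hs heq y hy)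

/-- The states of `Z` at which the maximizer cannot achieve the value by optimal moves alone if
`U` counts as lost. -/
noncomputable def shortfall (G : StochasticGame S) (T Z : Set S) : Set S →o Set S where
  toFun U := {x ∈ Z | G.optimalValue T Z U x < G.reachValue T x}
  monotone' _ _ hUV _ hx := ⟨hx.1,
    (value_mono (fun _ => subset_rfl) (Set.union_subset_union_left _ hUV) _).trans_lt hx.2⟩

theorem notMem_of_mem_shortfall (hG : G.FinitelyBranching) (hs : s ∈ G.shortfall T Z U) :
    s ∉ T := fun hT => hs.2.ne <| by
  rw [optimalValue, reachValue, value_of_mem_target hG hT, value_of_mem_target hG hT]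

/-- The part of `Z` in which the minimizer can keep the maximizer strictly below the value. -/
noncomputable def deficientRegion (G : StochasticGame S) (T Z : Set S) : Set S :=
  (G.shortfall T Z).lfp

theorem shortfall_deficientRegion :
    G.shortfall T Z (G.deficientRegion T Z) = G.deficientRegion T Z :=
  (G.shortfall T Z).map_lfp

theorem notMem_of_mem_deficientRegion (hG : G.FinitelyBranching)
    (hs : s ∈ G.deficientRegion T Z) : s ∉ T :=
  notMem_of_mem_shortfall hG (shortfall_deficientRegion.symm.subset hs)

theorem optimalValue_deficientRegion (hsZ : s ∈ Z) (hs : s ∉ G.deficientRegion T Z) :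
    G.optimalValue T Z (G.deficientRegion T Z) s = G.reachValue T s := by
  refine (optimalValue_le_reachValue s).antisymm (not_lt.1 fun hlt => hs ?_)
  exact shortfall_deficientRegion.subset ⟨hsZ, hlt⟩

theorem IsIndifferent.exists_selector_reachValue_le [Countable S] (hZ : G.IsIndifferent T Z)
    (hG : G.FinitelyBranching) : ∃ f : G.Selector, ∀ x ∈ Z, x ∉ G.deficientRegion T Z →
      G.reachValue T x ≤ G.value f.moves T ∅ x := by
  obtain ⟨f, hf⟩ := exists_selector_forall_value_le_of_eq_zero_or_eq (T := T)
    (D := G.deficientRegion T Z ∪ Zᶜ) hG (isRestriction_optimalMoves hG T)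
    fun x hx h y hy => by
      simp only [Set.mem_union, Set.mem_compl_iff, not_or, not_not] at hx
      obtain ⟨hxT, hxL, hxZ⟩ := hx
      by_cases hyL : y ∈ G.deficientRegion T Z
      · exact Or.inl (value_of_mem_dead hG (notMem_of_mem_deficientRegion hG hyL) (Or.inl hyL))
      · have hyZ : y ∈ Z := hZ.max x hxZ hxT h hy
        right
        calc G.optimalValue T Z (G.deficientRegion T Z) y
            = G.reachValue T y := optimalValue_deficientRegion hyZ hyL
          _ = G.reachValue T x := reachValue_eq_of_mem_optimalMoves hG hxT h hy
          _ = _ := (optimalValue_deficientRegion hxZ hxL).symm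
  refine ⟨f, fun x hxZ hxL => ?_⟩
  calc G.reachValue T x
      = G.optimalValue T Z (G.deficientRegion T Z) x :=
        (optimalValue_deficientRegion hxZ hxL).symm
    _ ≤ G.value f.moves T (G.deficientRegion T Z ∪ Zᶜ) x := hf x
    _ ≤ G.value f.moves T ∅ x := value_mono (fun _ => subset_rfl) (Set.empty_subset _) x

theorem IsIndifferent.optimalValue_le_of_isMinOn (hZ : G.IsIndifferent T Z)
    (hG : G.FinitelyBranching) (hs : s ∉ T ∪ (U ∪ Zᶜ)) (h : G.kind s = .minimizer)
    (hf : s ∈ G.shortfall T Z U → IsMinOn (G.optimalValue T Z U) (G.successors s) (f s)) :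
    G.optimalValue T Z U (f s) ≤ G.optimalValue T Z U s := by
  by_cases hsU : s ∈ G.shortfall T Z U
  · nth_rw 2 [optimalValue]
    rw [value_min hG hs h]
    exact le_iInf₂ (hf hsU)
  · simp only [Set.mem_union, Set.mem_compl_iff, not_or, not_not] at hs
    calc G.optimalValue T Z U (f s) ≤ G.reachValue T (f s) := optimalValue_le_reachValue _
      _ = G.reachValue T s := (hZ.min s hs.2.2 hs.1 h _ (f.step s)).1
      _ ≤ G.optimalValue T Z U s := not_lt.1 fun hlt => hsU ⟨hs.2.2, hlt⟩

theorem IsIndifferent.exists_isValueOptimal_isMinOn (hZ : G.IsIndifferent T Z)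
    (hG : G.FinitelyBranching) (u : S → S → ℝ≥0∞) :
    ∃ f : G.Selector, IsValueOptimal T f ∧ ∀ x ∈ Z, IsMinOn (u x) (G.successors x) (f x) := by
  classical
  obtain ⟨f, hf⟩ := exists_selector_isMinOn hG fun x => if x ∈ Z then u x else G.reachValue T
  refine ⟨f, fun x hxT h => ?_, fun x hx => by simpa only [if_pos hx] using hf x⟩
  by_cases hx : x ∈ Z
  · exact (hZ.min x hx hxT h _ (f.step x)).1.le
  · exact reachValue_le_of_isMinOn hG hxT h (by simpa only [if_neg hx] using hf x)

-- The stages of the least fixed point rank the states of the region; the selector minimizes the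
-- chances of the maximizer in the game in which the states of lower rank count as lost.
theorem IsIndifferent.exists_selector_hitProb_lt (hZ : G.IsIndifferent T Z)
    (hG : G.FinitelyBranching) : ∃ f : G.Selector, ∀ σ : G.MaxStrategy,
      ∀ x ∈ G.deficientRegion T Z, ∀ w,
        G.hitProb T σ (f.strategy .minimizer) w x < G.reachValue T x := by
  obtain ⟨ρ, hρ⟩ := exists_rank_lfp (G.shortfall T Z)
  let below : Ordinal → Set S := fun a => {y ∈ G.deficientRegion T Z | ρ y < a}
  have shortfall_below : ∀ a, G.shortfall T Z (below a) =
    {y ∈ G.deficientRegion T Z | ρ y ≤ a} := hρ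
  obtain ⟨f, f_optimal, f_min⟩ :=
    hZ.exists_isValueOptimal_isMinOn hG fun x => G.optimalValue T Z (below (ρ x))
  refine ⟨f, fun σ x => ?_⟩
  induction hα : ρ x using WellFoundedLT.induction generalizing x with
  | ind α ih =>
    subst hα
    intro hx w
    have hx_shortfall : x ∈ G.shortfall T Z (below (ρ x)) :=
      (shortfall_below (ρ x)).symm.subset ⟨hx, le_rfl⟩
    refine (f_optimal.hitProb_le hG σ w x).lt_of_ne fun heq => hx_shortfall.2.not_ge ?_
    rw [← heq]
    refine iSup_le fun n => hZ.hitWithin_le_optimalValue hG f_optimal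
      (fun y hy => ih (ρ y) hy.2 y rfl hy.1) (fun y hy h => ?_) n w hx_shortfall.1 heq
    refine hZ.optimalValue_le_of_isMinOn hG hy h fun hy_shortfall => ?_
    obtain ⟨hyL, hyx⟩ := (shortfall_below (ρ x)).subset hy_shortfall
    have rank_eq : ρ y = ρ x :=
      hyx.antisymm (not_lt.1 fun hlt => hy (Or.inr (Or.inl ⟨hyL, hlt⟩)))
    exact rank_eq ▸ f_min y hy_shortfall.1

end Indifferent

section Determinacy

variable {S : Type*} [Countable S] [MeasurableSpace S] [DiscreteMeasurableSpace S]
  {G : StochasticGame S} {T D : Set S} {f : G.Selector} {s : S}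

theorem value_le_playMeasure (f : G.Selector) (π : G.MinStrategy) (s : S) :
    G.value f.moves T D s ≤ G.playMeasure s (f.strategy .maximizer) π (reach T) := by
  rw [playMeasure_reach]
  exact value_le_hitProb f π [] s

theorem IsValueOptimal.playMeasure_le (hf : IsValueOptimal T f) (hG : G.FinitelyBranching)
    (σ : G.MaxStrategy) (s : S) :
    G.playMeasure s σ (f.strategy .minimizer) (reach T) ≤ G.reachValue T s := by
  rw [playMeasure_reach]
  exact hf.hitProb_le hG σ [] s

theorem exists_md_lt_playMeasure (hG : G.FinitelyBranching) {t : ℝ≥0∞}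
    (ht : t < G.reachValue T s) :
    ∃ σ : G.MaxStrategy, σ.IsMD ∧ ∃ t' > t, ∀ π : G.MinStrategy,
      t' ≤ G.playMeasure s σ π (reach T) := by
  obtain ⟨f, -, hf, -⟩ := exists_selector_lt_value hG (isRestriction_successors G) ht
  exact ⟨f.strategy .maximizer, f.strategy_isMD _, _, hf, fun π => value_le_playMeasure f π s⟩

theorem exists_md_playMeasure_le (hG : G.FinitelyBranching) (T : Set S) (s : S) :
    ∃ π : G.MinStrategy, π.IsMD ∧ ∀ σ : G.MaxStrategy,
      G.playMeasure s σ π (reach T) ≤ G.reachValue T s := by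
  obtain ⟨f, hf⟩ := exists_isValueOptimal hG T
  exact ⟨f.strategy .minimizer, f.strategy_isMD _, fun σ => hf.playMeasure_le hG σ s⟩

theorem hasValue_reachValue (hG : G.FinitelyBranching) (T : Set S) (s : S) :
    G.HasValue (reach T) s (G.reachValue T s) := by
  have le_sup_inf : G.reachValue T s ≤
      ⨆ σ : G.MaxStrategy, ⨅ π : G.MinStrategy, G.playMeasure s σ π (reach T) := by
    refine le_of_forall_lt fun t ht => ?_
    obtain ⟨σ, -, t', ht', hσ⟩ := exists_md_lt_playMeasure hG ht
    exact ht'.trans_le (le_iSup_of_le σ (le_iInf hσ))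
  have inf_sup_le : (⨅ π : G.MinStrategy, ⨆ σ : G.MaxStrategy,
      G.playMeasure s σ π (reach T)) ≤ G.reachValue T s := by
    obtain ⟨π, -, hπ⟩ := exists_md_playMeasure_le hG T s
    exact iInf_le_of_le π (iSup_le hπ)
  have sup_inf_le_inf_sup := iSup_iInf_le_iInf_iSup
    fun (σ : G.MaxStrategy) (π : G.MinStrategy) => G.playMeasure s σ π (reach T)
  exact ⟨(sup_inf_le_inf_sup.trans inf_sup_le).antisymm le_sup_inf,
    inf_sup_le.antisymm (le_sup_inf.trans sup_inf_le_inf_sup)⟩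

/-- Strong MD-determinacy at a single state `s`, for the objective to reach `T` with at least the
probability that is the value of `s`. -/
def MDDeterminedAtValue (G : StochasticGame S) (T : Set S) (s : S) : Prop :=
  (∃ σ : G.MaxStrategy, σ.IsMD ∧ ∀ π : G.MinStrategy,
    G.reachValue T s ≤ G.playMeasure s σ π (reach T)) ∨
  (∃ π : G.MinStrategy, π.IsMD ∧ ∀ σ : G.MaxStrategy,
    G.playMeasure s σ π (reach T) < G.reachValue T s)

theorem mdDeterminedAtValue_of_not_valueDecreasing (hG : G.FinitelyBranching)
    (h : ∀ s s', G.kind s = .maximizer → G.step s s' → ¬ G.ValueDecreasing (reach T) s s')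
    (s : S) : G.MDDeterminedAtValue T s := by
  obtain ⟨f, hf⟩ := exists_selector_forall_value_le (T := T) (D := ∅) hG
    (isRestriction_successors G) fun x _ hk y hy =>
      (reachValue_le_of_step hG hk hy).antisymm (not_lt.1 fun hlt => h x y hk hy
        ⟨_, _, hasValue_reachValue hG T x, hasValue_reachValue hG T y, hlt⟩)
  exact Or.inl ⟨f.strategy .maximizer, f.strategy_isMD _,
    fun π => (hf s).trans (value_le_playMeasure f π s)⟩

theorem IsIndifferent.mdDeterminedAtValue {Z : Set S} (hZ : G.IsIndifferent T Z)
    (hG : G.FinitelyBranching) (hs : s ∈ Z) : G.MDDeterminedAtValue T s := by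
  by_cases hsL : s ∈ G.deficientRegion T Z
  · obtain ⟨f, hf⟩ := hZ.exists_selector_hitProb_lt hG
    refine Or.inr ⟨f.strategy .minimizer, f.strategy_isMD _, fun σ => ?_⟩
    rw [playMeasure_reach]
    exact hf σ s hsL []
  · obtain ⟨f, hf⟩ := hZ.exists_selector_reachValue_le hG
    exact Or.inl ⟨f.strategy .maximizer, f.strategy_isMD _,
      fun π => (hf s hs hsL).trans (value_le_playMeasure f π s)⟩

theorem isIndifferent_univ (hG : G.FinitelyBranching)
    (h : ∀ s s', G.kind s = .minimizer → G.step s s' → ¬ G.ValueIncreasing (reach T) s s') :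
    G.IsIndifferent T Set.univ where
  max x _ _ _ := Set.subset_univ (G.optimalMoves T x)
  min x _ hT hk y hy := by
    refine ⟨le_antisymm (not_lt.1 fun hlt => ?_) (le_reachValue_of_step hG hT hk hy), trivial⟩
    exact h x y hk hy ⟨_, _, hasValue_reachValue hG T x, hasValue_reachValue hG T y, hlt⟩
  random x _ _ hk := Set.subset_univ (G.prob ⟨x, hk⟩).support

theorem stronglyMDDetermined_ge (hG : G.FinitelyBranching) {c : ℝ≥0∞}
    (h : ∀ s, G.reachValue T s = c → G.MDDeterminedAtValue T s) :
    G.StronglyMDDetermined (reach T) .ge c := by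
  intro s
  rcases lt_trichotomy (G.reachValue T s) c with hlt | rfl | hgt
  · obtain ⟨π, hπ, hle⟩ := exists_md_playMeasure_le hG T s
    exact Or.inr ⟨π, hπ, fun σ => ((hle σ).trans_lt hlt).not_ge⟩
  · exact (h s rfl).imp_right fun ⟨π, hπ, hlt⟩ => ⟨π, hπ, fun σ => (hlt σ).not_ge⟩
  · obtain ⟨σ, hσ, t, ht, hle⟩ := exists_md_lt_playMeasure hG hgt
    exact Or.inl ⟨σ, hσ, fun π => ht.le.trans (hle π)⟩

theorem stronglyMDDetermined_gt (hG : G.FinitelyBranching) (T : Set S) (c : ℝ≥0∞) :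
    G.StronglyMDDetermined (reach T) .gt c := by
  intro s
  rcases lt_or_ge c (G.reachValue T s) with hlt | hge
  · obtain ⟨σ, hσ, t, ht, hle⟩ := exists_md_lt_playMeasure hG hlt
    exact Or.inl ⟨σ, hσ, fun π => ht.trans_le (hle π)⟩
  · obtain ⟨π, hπ, hle⟩ := exists_md_playMeasure_le hG T s
    exact Or.inr ⟨π, hπ, fun σ => ((hle σ).trans hge).not_gt⟩

end Determinacy

end StochasticGame

theorem theorem5 {S : Type*} [Countable S] [MeasurableSpace S] [DiscreteMeasurableSpace S]
    (G : StochasticGame S) (hG : G.FinitelyBranching) (T : Set S)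
    (r : StochasticGame.ThresholdRel) (c : ℝ≥0) (hc : c ≤ 1)
    (h : (∀ s s', G.kind s = .maximizer → G.step s s' →
            ¬ G.ValueDecreasing (StochasticGame.reach T) s s') ∨
         (∀ s s', G.kind s = .minimizer → G.step s s' →
            ¬ G.ValueIncreasing (StochasticGame.reach T) s s') ∨
         (r = .ge ∧ c = 1) ∨
         r = .gt) :
    G.StronglyMDDetermined (StochasticGame.reach T) r c := by
  cases r with
  | gt => exact StochasticGame.stronglyMDDetermined_gt hG T c
  | ge =>
    refine StochasticGame.stronglyMDDetermined_ge hG fun s hs => ?_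
    rcases h with not_decreasing | not_increasing | ⟨-, rfl⟩ | ge_eq_gt
    · exact StochasticGame.mdDeterminedAtValue_of_not_valueDecreasing hG not_decreasing s
    · exact (StochasticGame.isIndifferent_univ hG not_increasing).mdDeterminedAtValue hG trivial
    · exact (StochasticGame.isIndifferent_value_one hG T).mdDeterminedAtValue hG (by simpa using hs)
    · cases ge_eq_gt
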